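/- Let $q\ge 5$ be an odd integer and let $\mathcal A_q=\{-q+1,-q+3,\dots,q-3,q-1\}$. Call a sequence $(x_1,\dots,x_n)\in\mathcal A_q^n$, $n\ge 1$, \emph{charge and polarity balanced} (CPB) if $\sum_{i=1}^n x_i=0$ and the number of indices $i$ with $x_i>0$ equals the number of indices with $x_i<0$. Let $M_{\rm CPB}(n,q)$ be the number of CPB sequences of length $n$ over $\mathcal A_q$. A CPB code of length $n$ is a nonempty set $C$ of CPB sequences of length $n$; its redundancy is $n-\log_q|C|$. Then the following hold. (1) As $n\to\infty$ with $q$ fixed, $$M_{\rm CPB}(n,q)\sim q^n\,\frac{1}{\pi n}\sqrt{\frac{12q^2}{(q^2-1)(q-1)(q-3)}},$$ that is, the ratio of the two sides tends to $1$. (2) For every $n\ge 1$ the minimum redundancy $r_{\rm CPB}(n,q)$ of CPB codes of length $n$ over $\mathcal A_q$ is attained and equals $n-\log_q M_{\rm CPB}(n,q)$, and, as $n\to\infty$ with $q$ fixed, $$r_{\rm CPB}(n,q)-\left(\log_q n+\log_q\!\left(\pi\sqrt{\frac{(q^2-1)(q-1)(q-3)}{12q^2}}\right)\right)\to 0 .$$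 -/

import Mathlib

/-- The alphabet `{-q+1, -q+3, …, q-3, q-1}` of `q` integer symbols. -/
def symbolAlphabet (q : ℕ) : Finset ℤ :=
  (Finset.range q).image (fun j : ℕ => 2 * (j : ℤ) - (q : ℤ) + 1)

/-- Sequences of length `n` over the `q`-ary alphabet. -/
abbrev Word (q n : ℕ) : Type := Fin n → {a : ℤ // a ∈ symbolAlphabet q}

/-- Charge balanced: the sum of all symbols is zero. -/
def IsChargeBalanced {q n : ℕ} (x : Word q n) : Prop :=
  ∑ i, (x i : ℤ) = 0

/-- Polarity balanced: there are as many positive as negative symbols. -/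
def IsPolarityBalanced {q n : ℕ} (x : Word q n) : Prop :=
  (Finset.univ.filter (fun i => 0 < (x i : ℤ))).card =
    (Finset.univ.filter (fun i => (x i : ℤ) < 0)).card

/-- The set of all charge and polarity balanced (CPB) sequences of length `n`. -/
def cpbWords (q n : ℕ) : Set (Word q n) :=
  {x | IsChargeBalanced x ∧ IsPolarityBalanced x}

/-- The number of CPB sequences of length `n`. -/
noncomputable def numCPB (q n : ℕ) : ℕ := (cpbWords q n).ncard

/-- The redundancy `n - log_q M` of a code (a set of sequences of length `n`) of size `M`. -/
noncomputable def redundancy {q n : ℕ} (C : Set (Word q n)) : ℝ :=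
  (n : ℝ) - Real.logb (q : ℝ) (C.ncard : ℝ)

/-- The redundancies of all nonempty CPB codes of length `n`, a CPB code being a code all of
whose codewords are CPB. -/
def cpbRedundancies (q n : ℕ) : Set ℝ :=
  {r | ∃ C : Set (Word q n), C.Nonempty ∧ C ⊆ cpbWords q n ∧ r = redundancy C}

/-- The minimum redundancy of CPB codes of length `n`. -/
noncomputable def minRedundancyCPB (q n : ℕ) : ℝ := sInf (cpbRedundancies q n)

/-! Count by Fourier inversion, then apply Laplace's method. With `q = 2m + 1` all symbols are even,
so a word is CPB exactly when the lattice vectors (`x / 2`, `sign x`) of its letters sum to zero.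
After a unimodular change of basis, orthogonality of characters on the square of side `2π` turns the
count into the integral of `charSum m ^ n` (`setIntegral_charSum_pow`). In the new basis ±2 and ±4
have frequencies ±(1,0) and ±(0,1), so `cos z.1` and `cos z.2` are summands of `charSum`. These
alone force Gaussian decay on the whole square (`abs_charSum_le`): the origin is the only peak.
Rescaling by `√n` and dominated convergence leave a planar Gaussian integral, whose determinant
gives the constant. Redundancy follows by taking logarithms, the full CPB set being an optimal code.
-/

/-! ### Fourier inversion for the CPB count -/

open MeasureTheory Filter Real in
theorem setIntegral_exp_int_mul_I (k : ℤ) :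
    ∫ x in Set.Ioc (-π) π, Complex.exp (k * x * Complex.I) = if k = 0 then 2 * (π : ℂ) else 0 := by
  rw [← intervalIntegral.integral_of_le (by linarith [pi_pos])]
  split_ifs with h
  · simp [h]; ring
  · have hc : (k : ℂ) * Complex.I ≠ 0 := by simp [h]
    have := integral_exp_mul_complex (a := -π) (b := π) hc
    simp_rw [show ∀ x : ℝ, (k : ℂ) * x * Complex.I = k * Complex.I * x from fun x => by ring]
    rw [this, div_eq_zero_iff]
    left
    rw [sub_eq_zero, Complex.exp_eq_exp_iff_exists_int]
    exact ⟨k, by push_cast; ring⟩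

/-- The symbol sum of the characters with frequencies `(2 sgn j - j, j - sgn j)` at the symbols
`2 j`, for `|j| ≤ m`. -/
noncomputable def charSum (m : ℕ) (z : ℝ × ℝ) : ℝ :=
  1 + 2 * ∑ k ∈ Finset.range m, Real.cos ((1 - k) * z.1 + k * z.2)

theorem sum_symbolAlphabet {M : Type*} [AddCommMonoid M] (m : ℕ) (f : ℤ → M) :
    ∑ x ∈ symbolAlphabet (2 * m + 1), f x =
      f 0 + ∑ k ∈ Finset.range m, (f (2 * (k + 1)) + f (-(2 * (k + 1)))) := by
  rw [symbolAlphabet, Finset.sum_image (by intro a _ b _ h; simp only at h; omega)]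
  induction m with
  | zero => simp
  | succ m ih =>
    rw [show 2 * (m + 1) + 1 = (2 * m + 1) + 1 + 1 by ring, Finset.sum_range_succ,
      Finset.sum_range_succ', Finset.sum_range_succ (n := m), ← add_assoc, ← ih]
    rw [add_assoc, add_comm (f _) (f _)]
    congr 1
    · refine Finset.sum_congr rfl fun k _ => congrArg f ?_
      push_cast; ring
    · congr 1
      all_goals
        refine congrArg f ?_
        push_cast
        ring

theorem even_of_mem_symbolAlphabet {q : ℕ} (hodd : Odd q) {x : ℤ} (hx : x ∈ symbolAlphabet q) :
    2 * (x / 2) = x := by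
  obtain ⟨m, rfl⟩ := hodd
  simp only [symbolAlphabet, Finset.mem_image] at hx
  obtain ⟨j, -, rfl⟩ := hx
  push_cast
  omega

theorem isPolarityBalanced_iff_sum_sign {q n : ℕ} (x : Word q n) :
    IsPolarityBalanced x ↔ ∑ i, (x i : ℤ).sign = 0 := by
  have h : ∀ a : ℤ, a.sign = (if 0 < a then 1 else 0) - (if a < 0 then 1 else 0) := by
    intro a
    rcases lt_trichotomy a 0 with h | rfl | h
    · simp [Int.sign_eq_neg_one_of_neg h, h, h.not_gt]
    · simp
    · simp [Int.sign_eq_one_of_pos h, h, h.not_gt]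
  simp_rw [h, Finset.sum_sub_distrib, Finset.sum_boole, sub_eq_zero, IsPolarityBalanced]
  norm_cast

/-- The matrix with rows (2, -1), (-1, 1) has determinant 1, so both pairs of sums vanish together.
-/
theorem mem_cpbWords_iff {q n : ℕ} (hodd : Odd q) (x : Word q n) :
    x ∈ cpbWords q n ↔ ∑ i, (2 * (x i : ℤ).sign - (x i : ℤ) / 2) = 0 ∧
      ∑ i, ((x i : ℤ) / 2 - (x i : ℤ).sign) = 0 := by
  have h : ∑ i, (x i : ℤ) = 2 * ∑ i, (x i : ℤ) / 2 := by
    rw [Finset.mul_sum]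
    exact Finset.sum_congr rfl fun i _ => (even_of_mem_symbolAlphabet hodd (x i).2).symm
  rw [cpbWords, Set.mem_ofPred_eq, isPolarityBalanced_iff_sum_sign, IsChargeBalanced, h,
    Finset.sum_sub_distrib, Finset.sum_sub_distrib, ← Finset.mul_sum]
  omega

theorem sum_character_eq_charSum (m : ℕ) (z : ℝ × ℝ) :
    ∑ x : {a : ℤ // a ∈ symbolAlphabet (2 * m + 1)},
      Complex.exp (((2 * (x : ℤ).sign - (x : ℤ) / 2 : ℤ) : ℂ) * z.1 * Complex.I) *
        Complex.exp ((((x : ℤ) / 2 - (x : ℤ).sign : ℤ) : ℂ) * z.2 * Complex.I) =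
      (charSum m z : ℂ) := by
  rw [Finset.sum_coe_sort (symbolAlphabet (2 * m + 1)) (fun x : ℤ =>
    Complex.exp (((2 * x.sign - x / 2 : ℤ) : ℂ) * z.1 * Complex.I) *
        Complex.exp (((x / 2 - x.sign : ℤ) : ℂ) * z.2 * Complex.I)), sum_symbolAlphabet, charSum]
  push_cast
  rw [Finset.mul_sum]
  congr 1
  · simp
  refine Finset.sum_congr rfl fun k _ => ?_
  have h1 : (2 * ((k : ℤ) + 1)).sign = 1 := Int.sign_eq_one_of_pos (by omega)
  have h2 : (2 * ((k : ℤ) + 1)) / 2 = k + 1 := by omega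
  have h3 : (-(2 * ((k : ℤ) + 1))) / 2 = -(k + 1) := by omega
  rw [Int.sign_neg, h1, h2, h3, ← Complex.exp_add, ← Complex.exp_add, Complex.two_cos]
  push_cast
  congr 2 <;> ring

open MeasureTheory Real in
theorem setIntegral_charSum_pow (m n : ℕ) :
    ∫ z in Set.Ioc (-π) π ×ˢ Set.Ioc (-π) π, charSum m z ^ n =
      (2 * π) ^ 2 * (numCPB (2 * m + 1) n : ℝ) := by
  classical
  have key : ∀ z : ℝ × ℝ, ((charSum m z ^ n : ℝ) : ℂ) = ∑ w : Word (2 * m + 1) n,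
      Complex.exp (((∑ i, (2 * (w i : ℤ).sign - (w i : ℤ) / 2) : ℤ) : ℂ) * z.1 * Complex.I) *
      Complex.exp (((∑ i, ((w i : ℤ) / 2 - (w i : ℤ).sign) : ℤ) : ℂ) * z.2 * Complex.I) := by
    intro z
    rw [Complex.ofReal_pow, ← sum_character_eq_charSum, Fintype.sum_pow]
    refine Finset.sum_congr rfl fun w _ => ?_
    rw [Finset.prod_mul_distrib, ← Complex.exp_sum, ← Complex.exp_sum, Int.cast_sum, Int.cast_sum,
      Finset.sum_mul, Finset.sum_mul, Finset.sum_mul, Finset.sum_mul]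
  have hint : ∀ a b : ℤ, IntegrableOn (fun z : ℝ × ℝ => Complex.exp (a * z.1 * Complex.I) *
      Complex.exp (b * z.2 * Complex.I)) (Set.Ioc (-π) π ×ˢ Set.Ioc (-π) π) := by
    intro a b
    refine IntegrableOn.mono_set (t := Set.Icc (-π) π ×ˢ Set.Icc (-π) π) ?_
      (Set.prod_mono Set.Ioc_subset_Icc_self Set.Ioc_subset_Icc_self)
    exact ContinuousOn.integrableOn_compact (isCompact_Icc.prod isCompact_Icc)
      (by fun_prop)
  apply Complex.ofReal_injective
  rw [← integral_complex_ofReal]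
  simp_rw [key]
  rw [integral_finsetSum _ fun w _ => hint _ _]
  have hw : ∀ w : Word (2 * m + 1) n, ∫ z : ℝ × ℝ in Set.Ioc (-π) π ×ˢ Set.Ioc (-π) π,
      Complex.exp (((∑ i, (2 * (w i : ℤ).sign - (w i : ℤ) / 2) : ℤ) : ℂ) * z.1 * Complex.I) *
      Complex.exp (((∑ i, ((w i : ℤ) / 2 - (w i : ℤ).sign) : ℤ) : ℂ) * z.2 * Complex.I) =
      if w ∈ cpbWords (2 * m + 1) n then (2 * (π : ℂ)) ^ 2 else 0 := by
    intro w
    rw [Measure.volume_eq_prod, setIntegral_prod_mul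
      (fun x : ℝ => Complex.exp (_ * x * Complex.I)) (fun x : ℝ => Complex.exp (_ * x * Complex.I)),
      setIntegral_exp_int_mul_I, setIntegral_exp_int_mul_I, mem_cpbWords_iff ⟨m, rfl⟩]
    split_ifs <;> first | tauto | ring
  simp_rw [hw]
  rw [← Finset.sum_filter, Finset.sum_const, nsmul_eq_mul, numCPB, Set.ncard_eq_toFinset_card']
  rw [← Set.filter_mem_univ_eq_toFinset]
  push_cast
  ring

/-! ### Planar Gaussian integral -/

open MeasureTheory Filter Real in
theorem integral_gaussian_quadratic_form {a b c : ℝ} (hc : 0 < c) (hD : 0 < a * c - b ^ 2)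
    (hint : Integrable (fun z : ℝ × ℝ =>
      rexp (-(a * z.1 ^ 2 + 2 * b * z.1 * z.2 + c * z.2 ^ 2)))) :
    ∫ z : ℝ × ℝ, rexp (-(a * z.1 ^ 2 + 2 * b * z.1 * z.2 + c * z.2 ^ 2)) =
      π / √(a * c - b ^ 2) := by
  rw [Measure.volume_eq_prod] at hint ⊢
  rw [integral_prod _ hint]
  have inner : ∀ x : ℝ, ∫ y : ℝ, rexp (-(a * x ^ 2 + 2 * b * x * y + c * y ^ 2)) =
      rexp (-((a * c - b ^ 2) / c) * x ^ 2) * √(π / c) := by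
    intro x
    -- Completing the square in `y` amounts to a translation by `b / c * x`.
    rw [← integral_gaussian, ← integral_const_mul,
      ← integral_add_right_eq_self (fun y : ℝ => rexp (-((a * c - b ^ 2) / c) * x ^ 2) *
        rexp (-c * y ^ 2)) (b / c * x)]
    refine integral_congr_ae (Eventually.of_forall fun y => ?_)
    simp only
    rw [← Real.exp_add]
    congr 1
    field_simp
    ring
  simp_rw [inner]
  rw [integral_mul_const, integral_gaussian, ← Real.sqrt_mul (by positivity)]
  rw [show π / ((a * c - b ^ 2) / c) * (π / c) = π ^ 2 / (a * c - b ^ 2) by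
    field_simp, Real.sqrt_div (by positivity), Real.sqrt_sq pi_pos.le]

/-! ### Decay and local limit of the character sum -/

theorem continuous_charSum (m : ℕ) : Continuous (charSum m) := by
  unfold charSum
  fun_prop

open Real in
theorem abs_charSum_le {m : ℕ} (hm : 2 ≤ m) {z : ℝ × ℝ}
    (hz : z ∈ Set.Ioc (-π) π ×ˢ Set.Ioc (-π) π) :
    |charSum m z / (2 * m + 1)| ≤ rexp (-((z.1 ^ 2 + z.2 ^ 2) / ((2 * m + 1) * π ^ 2))) := by
  obtain ⟨⟨h1, h2⟩, h3, h4⟩ := hz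
  obtain ⟨r, rfl⟩ := Nat.exists_eq_add_of_le' hm
  have hpi := pi_pos
  have ha := cos_le_one_sub_mul_cos_sq (abs_le.2 ⟨h1.le, h2⟩)
  have hb := cos_le_one_sub_mul_cos_sq (abs_le.2 ⟨h3.le, h4⟩)
  have hS := Finset.abs_sum_le_sum_abs
    (fun k : ℕ => cos ((1 - (k + 2 : ℕ)) * z.1 + (k + 2 : ℕ) * z.2)) (Finset.range r)
  have hS' := hS.trans (Finset.sum_le_card_nsmul _ _ 1 fun k _ => abs_cos_le_one _)
  rw [Finset.card_range, nsmul_eq_mul, mul_one, abs_le] at hS'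
  have hP : charSum (r + 2) z = 1 + 2 * (∑ k ∈ Finset.range r,
      cos ((1 - (k + 2 : ℕ)) * z.1 + (k + 2 : ℕ) * z.2) + cos z.2 + cos z.1) := by
    rw [charSum, Finset.sum_range_succ', Finset.sum_range_succ']
    simp
    exact Finset.sum_congr rfl fun k _ => by ring_nf
  have hx1 : z.1 ^ 2 ≤ π ^ 2 := sq_le_sq' h1.le h2
  have hx2 : z.2 ^ 2 ≤ π ^ 2 := sq_le_sq' h3.le h4
  refine le_trans ?_ (one_sub_le_exp_neg _)
  set w := (z.1 ^ 2 + z.2 ^ 2) / π ^ 2 with hw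
  have hw0 : 0 ≤ w := by positivity
  -- Needed for the lower bound: the symbol 0 contributes 1, so the sum is at least `-(q - 2)`,
  -- hence at least `-(q - w)`.
  have hw2 : w ≤ 2 := by rw [hw, div_le_iff₀ (by positivity)]; linarith
  have hsum : 2 / π ^ 2 * z.1 ^ 2 + 2 / π ^ 2 * z.2 ^ 2 = 2 * w := by rw [hw]; ring
  have hq : (0 : ℝ) < 2 * ((r + 2 : ℕ) : ℝ) + 1 := by positivity
  rw [abs_div, abs_of_pos hq, div_le_iff₀ hq, sub_mul,
    show (z.1 ^ 2 + z.2 ^ 2) / ((2 * ((r + 2 : ℕ) : ℝ) + 1) * π ^ 2) *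
      (2 * ((r + 2 : ℕ) : ℝ) + 1) = w by rw [hw]; field_simp, abs_le, hP]
  have := neg_one_le_cos z.1
  have := neg_one_le_cos z.2
  push_cast at *
  constructor <;> linarith

open Filter Real Topology in
theorem tendsto_mul_cos_div_sqrt_sub_one (x : ℝ) :
    Tendsto (fun n : ℕ => (n : ℝ) * (cos (x / √n) - 1)) atTop (𝓝 (-(x ^ 2 / 2))) := by
  have hs : Tendsto (fun n : ℕ => x / √(n : ℝ)) atTop (𝓝 0) :=
    tendsto_const_nhds.div_atTop (tendsto_sqrt_atTop.comp tendsto_natCast_atTop_atTop)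
  rw [tendsto_iff_dist_tendsto_zero]
  have hb : Tendsto (fun n : ℕ => x ^ 4 * (5 / 96) / (n : ℝ)) atTop (𝓝 0) :=
    tendsto_const_nhds.div_atTop tendsto_natCast_atTop_atTop
  refine squeeze_zero' (Eventually.of_forall fun _ => dist_nonneg) ?_ hb
  have h1 : ∀ᶠ n : ℕ in atTop, |x / √(n : ℝ)| ≤ 1 := by
    have := hs.abs
    rw [abs_zero] at this
    exact (this.eventually_lt_const one_pos).mono fun _ h => h.le
  filter_upwards [h1, eventually_gt_atTop 0] with n hn hpos
  have hn0 : (0 : ℝ) < n := by exact_mod_cast hpos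
  have hsq : √(n : ℝ) ^ 2 = n := Real.sq_sqrt hn0.le
  have h4 : |x / √(n : ℝ)| ^ 4 = x ^ 4 / n ^ 2 := by
    rw [show |x / √(n : ℝ)| ^ 4 = (|x / √(n : ℝ)| ^ 2) ^ 2 by ring, sq_abs, div_pow, hsq]
    ring
  have := cos_bound hn
  rw [h4, div_pow, hsq] at this
  rw [dist_eq, show (n : ℝ) * (cos (x / √n) - 1) - -(x ^ 2 / 2) =
    n * (cos (x / √n) - (1 - x ^ 2 / n / 2)) by field_simp; ring, abs_mul, abs_of_pos hn0]
  calc _ ≤ (n : ℝ) * (x ^ 4 / n ^ 2 * (5 / 96)) := by gcongr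
    _ = _ := by field_simp

open Filter Real Topology in
theorem tendsto_charSum_div_pow (m : ℕ) (z : ℝ × ℝ) :
    Tendsto (fun n : ℕ => (charSum m ((√(n : ℝ))⁻¹ • z) / (2 * m + 1)) ^ n) atTop
      (𝓝 (rexp (-((∑ k ∈ Finset.range m, ((1 - k) * z.1 + k * z.2) ^ 2) / (2 * m + 1))))) := by
  have hq : (0 : ℝ) < 2 * m + 1 := by positivity
  have h : ∀ n : ℕ, charSum m ((√(n : ℝ))⁻¹ • z) / (2 * m + 1) =
      1 + 2 / (2 * m + 1) * ∑ k ∈ Finset.range m,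
        (cos (((1 - k) * z.1 + k * z.2) / √n) - 1) := by
    intro n
    rw [charSum, Finset.sum_sub_distrib, Finset.sum_const, Finset.card_range, nsmul_eq_mul, mul_one]
    have : ∀ k : ℕ, (1 - (k : ℝ)) * ((√(n : ℝ))⁻¹ • z).1 + k * ((√(n : ℝ))⁻¹ • z).2 =
        ((1 - k) * z.1 + k * z.2) / √n := by
      intro k
      simp only [Prod.smul_fst, Prod.smul_snd, smul_eq_mul]
      ring
    simp_rw [this]
    generalize ∑ k ∈ Finset.range m, cos (((1 - (k : ℝ)) * z.1 + k * z.2) / √n) = s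
    field_simp
    ring
  simp_rw [h]
  apply tendsto_one_add_pow_exp_of_tendsto
  have := (tendsto_finsetSum (Finset.range m) fun k _ =>
    tendsto_mul_cos_div_sqrt_sub_one ((1 - (k : ℝ)) * z.1 + k * z.2)).const_mul
      (2 / (2 * (m : ℝ) + 1))
  convert this using 2
  · rw [← Finset.mul_sum]; ring
  · rw [Finset.sum_neg_distrib, ← Finset.sum_div]; ring

/-! ### The limiting quadratic form -/

theorem sum_range_sq_linear (m : ℕ) (x y : ℝ) :
    ∑ k ∈ Finset.range m, ((1 - (k : ℝ)) * x + k * y) ^ 2 =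
      (m * (2 * m ^ 2 - 9 * m + 13) / 6) * x ^ 2 + 2 * (m * (m - 1) * (2 - m) / 3) * x * y +
        (m * (m - 1) * (2 * m - 1) / 6) * y ^ 2 := by
  induction m with
  | zero => simp
  | succ m ih => rw [Finset.sum_range_succ, ih]; push_cast; ring

open MeasureTheory Real in
theorem integrable_exp_neg_mul_sq_add_sq {c : ℝ} (hc : 0 < c) :
    Integrable (fun z : ℝ × ℝ => rexp (-((z.1 ^ 2 + z.2 ^ 2) / c))) := by
  have h := integrable_exp_neg_mul_sq (inv_pos.2 hc)
  refine (h.mul_prod h).congr (Filter.Eventually.of_forall fun z => ?_)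
  simp only
  rw [← Real.exp_add]
  congr 1
  ring

open MeasureTheory Real in
theorem integral_exp_neg_sum_sq {m : ℕ} (hm : 2 ≤ m) :
    ∫ z : ℝ × ℝ, rexp (-((∑ k ∈ Finset.range m, ((1 - k) * z.1 + k * z.2) ^ 2) / (2 * m + 1))) =
      π * (2 * m + 1) / √(m ^ 2 * (m ^ 2 - 1) / 12 : ℝ) := by
  have hq : (0 : ℝ) < 2 * m + 1 := by positivity
  have hm' : (2 : ℝ) ≤ m := by exact_mod_cast hm
  have hint : Integrable (fun z : ℝ × ℝ => rexp (-((∑ k ∈ Finset.range m,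
      ((1 - k) * z.1 + k * z.2) ^ 2) / (2 * m + 1)))) := by
    refine (integrable_exp_neg_mul_sq_add_sq hq).mono' (by fun_prop)
      (Filter.Eventually.of_forall fun z => ?_)
    rw [norm_of_nonneg (exp_pos _).le]
    gcongr
    -- The terms `k = 0` and `k = 1` are exactly `z.1 ^ 2` and `z.2 ^ 2`.
    obtain ⟨r, rfl⟩ := Nat.exists_eq_add_of_le' hm
    rw [Finset.sum_range_succ', Finset.sum_range_succ']
    have : 0 ≤ ∑ k ∈ Finset.range r, ((1 - ((k + 1 + 1 : ℕ) : ℝ)) * z.1 +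
      (k + 1 + 1 : ℕ) * z.2) ^ 2 := Finset.sum_nonneg fun _ _ => sq_nonneg _
    norm_num at this ⊢
    linarith
  have hform : ∀ z : ℝ × ℝ,
      (∑ k ∈ Finset.range m, ((1 - (k : ℝ)) * z.1 + k * z.2) ^ 2) / (2 * m + 1) =
      (m * (2 * m ^ 2 - 9 * m + 13) / 6 / (2 * m + 1)) * z.1 ^ 2 +
        2 * (m * (m - 1) * (2 - m) / 3 / (2 * m + 1)) * z.1 * z.2 +
        (m * (m - 1) * (2 * m - 1) / 6 / (2 * m + 1)) * z.2 ^ 2 := by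
    intro z
    rw [sum_range_sq_linear]
    ring
  have hdet : (m * (2 * m ^ 2 - 9 * m + 13) / 6 / (2 * m + 1)) *
      (m * (m - 1) * (2 * m - 1) / 6 / (2 * m + 1)) -
      (m * (m - 1) * (2 - m) / 3 / (2 * m + 1)) ^ 2 =
      (m ^ 2 * (m ^ 2 - 1) / 12 : ℝ) / (2 * m + 1) ^ 2 := by
    field_simp
    ring
  have hD : (0 : ℝ) < m ^ 2 * (m ^ 2 - 1) / 12 := by
    have : (0 : ℝ) < m ^ 2 - 1 := by nlinarith
    positivity
  simp_rw [hform] at hint ⊢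
  rw [integral_gaussian_quadratic_form ?_ (by rw [hdet]; positivity) hint, hdet,
    Real.sqrt_div hD.le, Real.sqrt_sq hq.le, div_div_eq_mul_div]
  have h1 : (0 : ℝ) < m - 1 := by linarith
  have h2 : (0 : ℝ) < 2 * m - 1 := by linarith
  positivity

/-! ### Laplace's method -/

open MeasureTheory Filter Real Topology in
theorem tendsto_mul_setIntegral_charSum_pow {m : ℕ} (hm : 2 ≤ m) :
    Tendsto (fun n : ℕ => (n : ℝ) * ∫ z in Set.Ioc (-π) π ×ˢ Set.Ioc (-π) π,
      (charSum m z / (2 * m + 1)) ^ n) atTop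
      (𝓝 (π * (2 * m + 1) / √(m ^ 2 * (m ^ 2 - 1) / 12 : ℝ))) := by
  set S : Set (ℝ × ℝ) := Set.Ioc (-π) π ×ˢ Set.Ioc (-π) π with hS
  have hSm : MeasurableSet S := measurableSet_Ioc.prod measurableSet_Ioc
  rw [← integral_exp_neg_sum_sq hm]
  -- In dimension two, scaling by `1 / √n` has Jacobian `1 / n`, which absorbs the factor `n`.
  have hscale : (fun n : ℕ => (n : ℝ) * ∫ z in S, (charSum m z / (2 * m + 1)) ^ n) =ᶠ[atTop]
      fun n : ℕ => ∫ z : ℝ × ℝ,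
        S.indicator (fun z => (charSum m z / (2 * m + 1)) ^ n) ((√(n : ℝ))⁻¹ • z) := by
    filter_upwards with n
    rw [Measure.integral_comp_smul, integral_indicator hSm, smul_eq_mul]
    simp
  refine Tendsto.congr' hscale.symm ?_
  have hq : (0 : ℝ) < 2 * m + 1 := by positivity
  refine tendsto_integral_filter_of_dominated_convergence
    (fun z : ℝ × ℝ => rexp (-((z.1 ^ 2 + z.2 ^ 2) / ((2 * m + 1) * π ^ 2)))) ?_ ?_
    (integrable_exp_neg_mul_sq_add_sq (by positivity)) ?_
  · refine Eventually.of_forall fun n => Measurable.aestronglyMeasurable ?_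
    have : Measurable (charSum m) := (continuous_charSum m).measurable
    have h : Measurable (S.indicator (fun z => (charSum m z / (2 * m + 1)) ^ n)) :=
      Measurable.indicator (by fun_prop) hSm
    exact h.comp (measurable_const_smul _)
  · filter_upwards [eventually_gt_atTop 0] with n hn
    refine Eventually.of_forall fun z => ?_
    by_cases hz : (√(n : ℝ))⁻¹ • z ∈ S
    · rw [Set.indicator_of_mem hz, norm_pow, norm_eq_abs]
      refine (pow_le_pow_left₀ (abs_nonneg _) (abs_charSum_le hm hz) n).trans_eq ?_
      have hn0 : (0 : ℝ) < n := by exact_mod_cast hn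
      rw [← Real.exp_nat_mul]
      congr 1
      simp only [Prod.smul_fst, Prod.smul_snd, smul_eq_mul, mul_pow, inv_pow, sq_sqrt hn0.le]
      field_simp
    · rw [Set.indicator_of_notMem hz, norm_zero]
      exact (exp_pos _).le
  · refine Eventually.of_forall fun z => ?_
    refine (tendsto_charSum_div_pow m z).congr' ?_
    have h0 : Tendsto (fun n : ℕ => (√(n : ℝ))⁻¹ • z) atTop (𝓝 0) := by
      have : Tendsto (fun n : ℕ => (√(n : ℝ))⁻¹) atTop (𝓝 0) :=
        (tendsto_sqrt_atTop.comp tendsto_natCast_atTop_atTop).inv_tendsto_atTop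
      simpa using this.smul_const z
    have hnhds : S ∈ 𝓝 (0 : ℝ × ℝ) :=
      prod_mem_nhds (Ioc_mem_nhds (by simp [pi_pos]) pi_pos)
        (Ioc_mem_nhds (by simp [pi_pos]) pi_pos)
    filter_upwards [h0 hnhds] with n hn
    have hn' : (√(n : ℝ))⁻¹ • z ∈ S := hn
    rw [Set.indicator_of_mem hn']

/-! ### Optimal codes and final asymptotics -/

theorem cpbWords_nonempty {q : ℕ} (hodd : Odd q) (n : ℕ) : (cpbWords q n).Nonempty := by
  obtain ⟨m, rfl⟩ := hodd
  have h0 : (0 : ℤ) ∈ symbolAlphabet (2 * m + 1) := by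
    simp only [symbolAlphabet, Finset.mem_image, Finset.mem_range]
    exact ⟨m, by omega, by push_cast; ring⟩
  exact ⟨fun _ => ⟨0, h0⟩, by simp [IsChargeBalanced], by simp [IsPolarityBalanced]⟩

theorem isLeast_cpbRedundancies {q : ℕ} (hq : 1 < q) (hodd : Odd q) (n : ℕ) :
    IsLeast (cpbRedundancies q n) ((n : ℝ) - Real.logb (q : ℝ) (numCPB q n : ℝ)) := by
  refine ⟨⟨cpbWords q n, cpbWords_nonempty hodd n, subset_rfl, rfl⟩, ?_⟩
  rintro r ⟨C, hC, hsub, rfl⟩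
  have hpos : 0 < C.ncard := (Set.ncard_pos (Set.toFinite C)).2 hC
  have hle : C.ncard ≤ numCPB q n := Set.ncard_le_ncard hsub (Set.toFinite _)
  exact sub_le_sub_left (Real.logb_le_logb_of_le (by exact_mod_cast hq)
    (by exact_mod_cast hpos) (by exact_mod_cast hle)) _

open Filter Real Topology in
theorem tendsto_numCPB_mul_div_pow {m : ℕ} (hm : 2 ≤ m) :
    Tendsto (fun n : ℕ => (numCPB (2 * m + 1) n : ℝ) * n / ((2 * m + 1 : ℕ) : ℝ) ^ n) atTop
      (𝓝 ((2 * m + 1) / (4 * π * √(m ^ 2 * (m ^ 2 - 1) / 12 : ℝ)))) := by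
  have h := (tendsto_mul_setIntegral_charSum_pow hm).div_const ((2 * π) ^ 2)
  have hpi := pi_pos
  convert h using 2 with n
  · simp_rw [div_pow]
    rw [MeasureTheory.integral_div, setIntegral_charSum_pow]
    push_cast
    field_simp
  · field_simp
    ring

open Filter Real Topology in
theorem tendsto_numCPB_mul_div_pow_sqrt {q : ℕ} (hq : 5 ≤ q) (hodd : Odd q) :
    Tendsto (fun n : ℕ => (numCPB q n : ℝ) * n / (q : ℝ) ^ n) atTop
      (𝓝 (√(12 * (q : ℝ) ^ 2 / (((q : ℝ) ^ 2 - 1) * ((q : ℝ) - 1) * ((q : ℝ) - 3))) / π)) := by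
  obtain ⟨m, rfl⟩ := hodd
  have hm : 2 ≤ m := by omega
  have hm' : (2 : ℝ) ≤ m := by exact_mod_cast hm
  have h1 : (0 : ℝ) < m ^ 2 - 1 := by nlinarith
  convert tendsto_numCPB_mul_div_pow hm using 2
  have h2 : 12 * ((2 * m + 1 : ℕ) : ℝ) ^ 2 / ((((2 * m + 1 : ℕ) : ℝ) ^ 2 - 1) *
      (((2 * m + 1 : ℕ) : ℝ) - 1) * (((2 * m + 1 : ℕ) : ℝ) - 3)) =
      ((2 * m + 1) / 4) ^ 2 / (m ^ 2 * (m ^ 2 - 1) / 12) := by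
    have h3 : (m : ℝ) - 1 ≠ 0 := by linarith
    push_cast
    -- For `q = 2m + 1`, `q² - 1 = 4m(m + 1)` and `(q - 1)(q - 3) = 4m(m - 1)`.
    rw [show ((2 * (m : ℝ) + 1) ^ 2 - 1) * (2 * m + 1 - 1) * (2 * m + 1 - 3) =
      16 * (m ^ 2 * (m ^ 2 - 1)) by ring]
    field_simp
    norm_num
  rw [h2, Real.sqrt_div (by positivity), Real.sqrt_sq (by positivity)]
  field_simp

theorem mainTheorem2 (q : ℕ) (hq : 5 ≤ q) (hodd : Odd q) :
    Asymptotics.IsEquivalent Filter.atTop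
      (fun n : ℕ => (numCPB q n : ℝ))
      (fun n : ℕ => (q : ℝ) ^ n * (1 / (Real.pi * (n : ℝ))) *
        Real.sqrt (12 * (q : ℝ) ^ 2 /
          (((q : ℝ) ^ 2 - 1) * ((q : ℝ) - 1) * ((q : ℝ) - 3)))) ∧
    (∀ n : ℕ, 1 ≤ n →
      IsLeast (cpbRedundancies q n) (minRedundancyCPB q n) ∧
      minRedundancyCPB q n = (n : ℝ) - Real.logb (q : ℝ) (numCPB q n : ℝ)) ∧
    Filter.Tendsto
      (fun n : ℕ => minRedundancyCPB q n -
        (Real.logb (q : ℝ) (n : ℝ) +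
          Real.logb (q : ℝ) (Real.pi *
            Real.sqrt ((((q : ℝ) ^ 2 - 1) * ((q : ℝ) - 1) * ((q : ℝ) - 3)) /
              (12 * (q : ℝ) ^ 2)))))
      Filter.atTop (nhds 0) := by
  have hq' : (5 : ℝ) ≤ q := by exact_mod_cast hq
  have hq0 : (0 : ℝ) < q := by linarith
  have hpi := Real.pi_pos
  have hlim := tendsto_numCPB_mul_div_pow_sqrt hq hodd
  have hE : (0 : ℝ) < ((q : ℝ) ^ 2 - 1) * ((q : ℝ) - 1) * ((q : ℝ) - 3) := by
    have h1 : (0 : ℝ) < (q : ℝ) ^ 2 - 1 := by nlinarith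
    have h2 : (0 : ℝ) < (q : ℝ) - 1 := by linarith
    have h3 : (0 : ℝ) < (q : ℝ) - 3 := by linarith
    positivity
  have hmin : ∀ n : ℕ, minRedundancyCPB q n = (n : ℝ) - Real.logb (q : ℝ) (numCPB q n : ℝ) :=
    fun n => (isLeast_cpbRedundancies (by omega) hodd n).csInf_eq
  -- The two square roots in the statement are reciprocal, so a single constant `K` serves both.
  rw [← inv_div (12 * (q : ℝ) ^ 2), Real.sqrt_inv]
  have hK : 0 < √(12 * (q : ℝ) ^ 2 / (((q : ℝ) ^ 2 - 1) * ((q : ℝ) - 1) * ((q : ℝ) - 3))) := by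
    positivity
  generalize √(12 * (q : ℝ) ^ 2 / (((q : ℝ) ^ 2 - 1) * ((q : ℝ) - 1) * ((q : ℝ) - 3))) = K at *
  refine ⟨?_, fun n _ => ⟨?_, hmin n⟩, ?_⟩
  · rw [Asymptotics.isEquivalent_iff_tendsto_one]
    · have h := hlim.div_const (K / Real.pi)
      rw [div_self (by positivity)] at h
      refine h.congr' ?_
      filter_upwards [Filter.eventually_gt_atTop 0] with n hn
      have hn0 : (0 : ℝ) < n := by exact_mod_cast hn
      simp only [Pi.div_apply]
      field_simp
    · filter_upwards [Filter.eventually_gt_atTop 0] with n hn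
      have hn0 : (0 : ℝ) < n := by exact_mod_cast hn
      positivity
  · rw [hmin n]
    exact isLeast_cpbRedundancies (by omega) hodd n
  · have h := ((Real.continuousAt_log (by positivity : K / Real.pi ≠ 0)).tendsto.comp hlim).div_const
      (Real.log q)
    have h' := (h.add_const (Real.logb q (Real.pi * K⁻¹))).neg
    have hlog : Real.log (K / Real.pi) / Real.log q + Real.logb q (Real.pi * K⁻¹) = 0 := by
      rw [Real.log_div_log, ← Real.logb_mul (by positivity) (by positivity)]
      field_simp
      simp
    rw [hlog, neg_zero] at h'
    refine h'.congr' ?_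
    filter_upwards [Filter.eventually_gt_atTop 0] with n hn
    have hn0 : (0 : ℝ) < n := by exact_mod_cast hn
    have hN : (0 : ℝ) < numCPB q n := by
      exact_mod_cast (Set.ncard_pos (Set.toFinite _)).2 (cpbWords_nonempty hodd n)
    have hpow : Real.logb q ((q : ℝ) ^ n) = n := by
      rw [Real.logb_pow, Real.logb_self_eq_one (by linarith), mul_one]
    rw [hmin n, Function.comp_apply, Real.log_div_log, Real.logb_div (by positivity) (by positivity),
      Real.logb_mul (by positivity) (by positivity), hpow]
    ring
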